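/- **Setting.** A rule is a sentence $\forall\bar x\,\forall\bar y\,(\varphi(\bar x,\bar y)\to\exists\bar z\,\psi(\bar x,\bar z))$, where the body $\varphi$ and the head $\psi$ are finite conjunctions of atoms over constants and variables. Let $\Sigma$ be a finite set of rules. A position $p[i]$ is *invaded* by an existential variable $y$ of a rule of $\Sigma$ if some head atom of that rule has $y$ at $p[i]$ or, recursively, some head atom of a rule of $\Sigma$ has at $p[i]$ a universal variable that occurs in the body of its rule only in positions invaded by $y$. A universal variable of a rule is *attacked* by $y$ if it occurs in the body only in positions invaded by $y$, and *protected* if no existential variable attacks it. $\Sigma$ is *Shy* if in each rule (1) every variable that occurs in more than one body atom is protected, and (2) any two distinct universal variables that are not protected and occur both in the head and in two different body atoms are not attacked by the same existential variable. A position is *affected* if some head atom has an existential variable there or, recursively, a universal variable all of whose body occurrences are in affected positions. A body variable is *harmless* if it has a body occurrence in a non-affected position, and *dangerous* if it is not harmless and occurs in the head. $\Sigma$ is *Warded* if each rule has no dangerous variable or has a body atom that contains all its dangerous variables and shares only harmless variables with the other body atoms. $\Sigma$ is *Protected* if it is both Shy and Warded. A database $D$ is a finite set of facts over constants. A Boolean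 conjunctive query $q$ is a finite conjunction of atoms over constants and variables, $\mathsf{vars}(q)$ is the set of its variables, and $I\models q$ means that there is a homomorphism (fixing constants) from $q$ to the set of facts $I$. The oblivious chase $\mathit{ochase}(D,\Sigma)$ starts from $D$ and fires every rule once along every homomorphism of its body to the facts derived so far, adding the head with fresh labelled nulls for the existential variables. The isomorphic chase $\mathit{ichase}(I,\Sigma)$ fires rules in the same way, in any order, but only when the facts to be added are not isomorphic (by a bijection of the nulls that fixes constants) to facts already present, until no firing is possible. $\lceil I\rfloor$ is obtained from $I$ by promoting all its nulls to fresh constants. Set $\mathit{ichase}_r(D,\Sigma,0)=D$ and $\mathit{ichase}_r(D,\Sigma,i)=\mathit{ichase}(\lceil\mathit{ichase}_r(D,\Sigma,i-1)\rfloor,\Sigma)$ for $i\ge 1$. **Theorem.** Let $\Sigma$ be a Protected set of rules, $D$ a database and $q$ a Boolean conjunctive query. Then a result of $\mathit{ichase}_r(D,\Sigma,|\mathsf{vars}(q)|+1)$ exists (it is reached after finitely many firings), and for every such result, whatever the order of the firings, $$\mathit{ochase}(D,\Sigma)\models q\quad\text{iff}\quad \mathit{ichase}_r(D,\Sigma,|\mathsf{vars}(q)|+1)\models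 q.$$ -/

import Mathlib

/-! Existential rules, the fragments Shy, Warded and Protected, the oblivious chase, and the
isomorphic chase with resumption. -/

namespace ExRules

universe u v w t

/-- A term of a rule or of a query: a constant or a variable. -/
inductive Term (C : Type v) (V : Type w) where
  | const (c : C)
  | var (x : V)

/-- An atom `p(t₁,…,tₖ)` over the schema `ar : P → ℕ` (predicates with their arities). -/
structure Atom {P : Type u} (ar : P → ℕ) (T : Type t) where
  pred : P
  args : Fin (ar pred) → T

/-- Apply a function to every argument of an atom. -/
def Atom.map {P : Type u} {ar : P → ℕ} {T : Type t} {T' : Type*} (f : T → T')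
    (a : Atom ar T) : Atom ar T' :=
  ⟨a.pred, fun i => f (a.args i)⟩

/-- A position `p[i]` of the schema. -/
abbrev Position {P : Type u} (ar : P → ℕ) : Type u := (p : P) × Fin (ar p)

/-- The set of variables of a finite conjunction of atoms. -/
def varsOf {P : Type u} {ar : P → ℕ} {C : Type v} {V : Type w}
    (A : Finset (Atom ar (Term C V))) : Set V :=
  {x | ∃ a ∈ A, ∃ i, a.args i = Term.var x}

/-- The variable `x` occurs in the atom `a`. -/
def Atom.HasVar {P : Type u} {ar : P → ℕ} {C : Type v} {V : Type w}
    (a : Atom ar (Term C V)) (x : V) : Prop :=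
  ∃ i, a.args i = Term.var x

/-- A rule `∀ x̄ ȳ (body(x̄,ȳ) → ∃ z̄ head(x̄,z̄))`; body and head are finite conjunctions of atoms.
The variables of the body are the universal ones; the variables of the head that
do not occur in the body are the existential ones. -/
structure Rule {P : Type u} (ar : P → ℕ) (C : Type v) (V : Type w) where
  body : Finset (Atom ar (Term C V))
  head : Finset (Atom ar (Term C V))

section Fragments

variable {P : Type u} {ar : P → ℕ} {C : Type v} {V : Type w}

/-- The existential variables of a rule. -/
def Rule.exVars (σ : Rule ar C V) : Set V := varsOf σ.head \ varsOf σ.body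

/-! ### Shy -/

/-- `Invaded S ρ y π`: the position `π` is invaded by the existential variable `y` of the rule
`ρ ∈ S`. Existential variables are identified by their rule together with their name, so that
rules need not be standardized apart. -/
inductive Invaded (S : Finset (Rule ar C V)) (ρ : Rule ar C V) (y : V) : Position ar → Prop
  | exist (hρ : ρ ∈ S) (hy : y ∈ ρ.exVars) (a : Atom ar (Term C V)) (ha : a ∈ ρ.head)
      (i : Fin (ar a.pred)) (hi : a.args i = Term.var y) : Invaded S ρ y ⟨a.pred, i⟩
  | propagate (σ : Rule ar C V) (hσ : σ ∈ S) (x : V) (hx : x ∈ varsOf σ.body)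
      (a : Atom ar (Term C V)) (ha : a ∈ σ.head)
      (i : Fin (ar a.pred)) (hi : a.args i = Term.var x)
      (hinv : ∀ b ∈ σ.body, ∀ j : Fin (ar b.pred), b.args j = Term.var x →
        Invaded S ρ y ⟨b.pred, j⟩) : Invaded S ρ y ⟨a.pred, i⟩

/-- The variable `x` is attacked in the body of `σ` by the existential variable `y` of `ρ`: it
occurs in the body of `σ`, and only in positions invaded by that existential variable. -/
def Attacked (S : Finset (Rule ar C V)) (ρ : Rule ar C V) (y : V) (σ : Rule ar C V) (x : V) :
    Prop :=
  x ∈ varsOf σ.body ∧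
    ∀ b ∈ σ.body, ∀ j : Fin (ar b.pred), b.args j = Term.var x → Invaded S ρ y ⟨b.pred, j⟩

/-- The variable `x` is protected in the body of `σ`: no existential variable attacks it. -/
def ProtectedVar (S : Finset (Rule ar C V)) (σ : Rule ar C V) (x : V) : Prop :=
  ∀ ρ ∈ S, ∀ y ∈ ρ.exVars, ¬ Attacked S ρ y σ x

/-- Shy rule sets. For each rule: (1) a variable that occurs in more than one body atom is
protected in the body; (2) two distinct universal variables that are not protected in the body and
occur both in the head and in two different body atoms are not attacked by the same existential
variable. -/
def Shy (S : Finset (Rule ar C V)) : Prop :=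
  ∀ σ ∈ S,
    (∀ x, ∀ a ∈ σ.body, ∀ b ∈ σ.body, a ≠ b → a.HasVar x → b.HasVar x → ProtectedVar S σ x) ∧
    (∀ x x', x ≠ x' → ¬ ProtectedVar S σ x → ¬ ProtectedVar S σ x' →
      x ∈ varsOf σ.head → x' ∈ varsOf σ.head →
      ∀ a ∈ σ.body, ∀ b ∈ σ.body, a ≠ b → a.HasVar x → b.HasVar x' →
        ∀ ρ ∈ S, ∀ y ∈ ρ.exVars, ¬ (Attacked S ρ y σ x ∧ Attacked S ρ y σ x'))

/-! ### Warded -/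

/-- Affected positions: those that hold an existential variable in some head and, recursively,
those that hold, in some head, a universal variable all of whose body occurrences are in affected
positions. -/
inductive Affected (S : Finset (Rule ar C V)) : Position ar → Prop
  | exist (σ : Rule ar C V) (hσ : σ ∈ S) (y : V) (hy : y ∈ σ.exVars)
      (a : Atom ar (Term C V)) (ha : a ∈ σ.head)
      (i : Fin (ar a.pred)) (hi : a.args i = Term.var y) : Affected S ⟨a.pred, i⟩
  | propagate (σ : Rule ar C V) (hσ : σ ∈ S) (x : V) (hx : x ∈ varsOf σ.body)
      (a : Atom ar (Term C V)) (ha : a ∈ σ.head)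
      (i : Fin (ar a.pred)) (hi : a.args i = Term.var x)
      (haff : ∀ b ∈ σ.body, ∀ j : Fin (ar b.pred), b.args j = Term.var x →
        Affected S ⟨b.pred, j⟩) : Affected S ⟨a.pred, i⟩

/-- A body variable is harmless if it has an occurrence in a non-affected body position. -/
def Harmless (S : Finset (Rule ar C V)) (σ : Rule ar C V) (x : V) : Prop :=
  ∃ b ∈ σ.body, ∃ j : Fin (ar b.pred), b.args j = Term.var x ∧ ¬ Affected S ⟨b.pred, j⟩

/-- A body variable is dangerous if it is harmful (not harmless) and occurs in the head. -/
def Dangerous (S : Finset (Rule ar C V)) (σ : Rule ar C V) (x : V) : Prop :=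
  x ∈ varsOf σ.body ∧ ¬ Harmless S σ x ∧ x ∈ varsOf σ.head

/-- Warded rule sets. Each rule has no dangerous variable, or has a body atom (the ward) that
contains all dangerous variables and shares only harmless variables with the other body atoms. -/
def Warded (S : Finset (Rule ar C V)) : Prop :=
  ∀ σ ∈ S,
    (∀ x, ¬ Dangerous S σ x) ∨
    ∃ a ∈ σ.body, (∀ x, Dangerous S σ x → a.HasVar x) ∧
      ∀ b ∈ σ.body, b ≠ a → ∀ x, a.HasVar x → b.HasVar x → Harmless S σ x

/-- Protected is the intersection of Shy and Warded. -/
def Protected (S : Finset (Rule ar C V)) : Prop := Shy S ∧ Warded S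

end Fragments

/-! ### Facts and homomorphisms -/

/-- The values that occur in facts: constants, labelled nulls, and frozen nulls (nulls that have
been promoted to constants). The null that is invented for the existential variable `z` when the
rule `σ` fires along the homomorphism `θ` of its body is labelled by `σ`, `z` and `θ`: this is the
usual naming that gives different applications different, hence fresh, nulls. -/
inductive Value {P : Type u} (ar : P → ℕ) (C : Type v) (V : Type w) where
  | const (c : C)
  | frozen (a : Value ar C V)
  | null (σ : Rule ar C V) (z : V) (θ : {x : V // x ∈ varsOf σ.body} → Value ar C V)

section Chase

variable {P : Type u} {ar : P → ℕ} {C : Type v} {V : Type w}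

/-- The values that play the role of constants: everything except the (unfrozen) nulls. -/
def Value.IsConstant : Value ar C V → Prop
  | .const _ => True
  | .frozen _ => True
  | .null _ _ _ => False

/-- Promotion of a null to a fresh constant. The constructor is also applied to the nulls that were
frozen earlier, which keeps them apart from those that are frozen now; the map is injective and
fixes the original constants. -/
def Value.freeze : Value ar C V → Value ar C V
  | .const c => .const c
  | .frozen a => .frozen (.frozen a)
  | .null σ z θ => .frozen (.null σ z θ)

/-- A fact. -/
abbrev Fact {P : Type u} (ar : P → ℕ) (C : Type v) (V : Type w) := Atom ar (Value ar C V)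

/-- The freezing `⌈I⌋` of a set of facts: all its nulls become constants. -/
def freeze (I : Set (Fact ar C V)) : Set (Fact ar C V) := Atom.map Value.freeze '' I

/-- A database, a finite set of facts over the constants, as a set of facts. -/
def ofDatabase (D : Finset (Atom ar C)) : Set (Fact ar C V) := Atom.map Value.const '' (D : Set _)

/-- The value of a term under an assignment of its variables; constants are fixed. -/
def Term.eval (h : V → Value ar C V) : Term C V → Value ar C V
  | .const c => .const c
  | .var x => h x

/-- `I ⊨ q`: some homomorphism maps the Boolean conjunctive query `q` to `I`. -/
def Entails (I : Set (Fact ar C V)) (q : Finset (Atom ar (Term C V))) : Prop :=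
  ∃ h : V → Value ar C V, ∀ a ∈ q, a.map (Term.eval h) ∈ I

open scoped Classical in
/-- The extension of an assignment `θ` of the body variables of `σ` that sends every existential
variable to the null invented for it. -/
noncomputable def extend (σ : Rule ar C V) (θ : {x : V // x ∈ varsOf σ.body} → Value ar C V) :
    V → Value ar C V :=
  fun x => if hx : x ∈ varsOf σ.body then θ ⟨x, hx⟩ else Value.null σ x θ

/-- `θ` is a homomorphism from the body of `σ` to `I`. -/
def Applicable (σ : Rule ar C V) (θ : {x : V // x ∈ varsOf σ.body} → Value ar C V)
    (I : Set (Fact ar C V)) : Prop :=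
  ∀ a ∈ σ.body, a.map (Term.eval (extend σ θ)) ∈ I

/-- The facts produced by firing `σ` along `θ`. -/
def fire (σ : Rule ar C V) (θ : {x : V // x ∈ varsOf σ.body} → Value ar C V) :
    Set (Fact ar C V) :=
  Atom.map (Term.eval (extend σ θ)) '' (σ.head : Set (Atom ar (Term C V)))

/-! ### The chase -/

/-- The oblivious chase `ochase(I,S)` of a set of facts without nulls: every rule fires exactly once
along every homomorphism of its body to the facts derived so far. -/
inductive ochase (S : Finset (Rule ar C V)) (I : Set (Fact ar C V)) : Set (Fact ar C V)
  | base (a : Fact ar C V) (ha : a ∈ I) : ochase S I a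
  | step (σ : Rule ar C V) (hσ : σ ∈ S) (θ : {x : V // x ∈ varsOf σ.body} → Value ar C V)
      (hbody : ∀ b ∈ σ.body, ochase S I (b.map (Term.eval (extend σ θ))))
      (a : Fact ar C V) (ha : a ∈ fire σ θ) : ochase S I a

/-- Two (finite) sets of facts are isomorphic: some bijection of the values that fixes the constants
maps the first set onto the second, so that it and its inverse are homomorphisms. -/
def Isomorphic (A B : Set (Fact ar C V)) : Prop :=
  ∃ h : Equiv.Perm (Value ar C V), (∀ a, a.IsConstant → h a = a) ∧ Atom.map h '' A = B

/-- A step of the isomorphic chase: a rule fires along an applicable homomorphism, provided that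
the facts it produces have no isomorphic copy among the facts present. -/
def IStep (S : Finset (Rule ar C V)) (I J : Set (Fact ar C V)) : Prop :=
  ∃ σ ∈ S, ∃ θ : {x : V // x ∈ varsOf σ.body} → Value ar C V,
    Applicable σ θ I ∧ (¬ ∃ B ⊆ I, Isomorphic (fire σ θ) B) ∧ J = I ∪ fire σ θ

/-- `J` is a result of `ichase(I,S)`, for a set `I` of facts without nulls: it is reached from `I` by
finitely many steps, fired in any order, and no step is possible from it. -/
def IsIChase (S : Finset (Rule ar C V)) (I J : Set (Fact ar C V)) : Prop :=
  Relation.ReflTransGen (IStep S) I J ∧ ∀ K, ¬ IStep S J K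

/-- `J` is a result of `i` rounds of the isomorphic chase with resumption: `ichase_r(D,S,0) = D` and
`ichase_r(D,S,i+1) = ichase(⌈ichase_r(D,S,i)⌋,S)`. -/
def IsIChaseR (S : Finset (Rule ar C V)) (D : Finset (Atom ar C)) :
    ℕ → Set (Fact ar C V) → Prop
  | 0, J => J = ofDatabase D
  | i + 1, J => ∃ K, IsIChaseR S D i K ∧ IsIChase S (freeze K) J

end Chase

end ExRules

namespace ExRules

/-! ### Values, instantiation of atoms, and the nesting order of nulls. -/

section Basics

variable {P : Type*} {ar : P → ℕ} {C V : Type*}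

/-! Soundness and existence hold for every finite rule set. A null is labelled by the trigger that
invented it, so undoing all freezing turns each firing in any round into a firing of `ochase` from
the database; a query match is carried along (`IsIChaseR.entails_ochase`). A round terminates
because a trigger is determined up to isomorphism by its rule, the equalities among its values and
the constants used, which leaves finitely many types, each fired at most once (`exists_isIChase`).

For completeness, one round already captures single facts: each fact of `ochase S I` maps, fixing
constants, into the result `J` (`exists_map_mem`). By Shy, different body atoms share only variables
sent to constants, so separate maps of the atoms glue to a trigger in `J`. By Warded, all nulls
passed to the head lie in one atom, so a single map also serves all produced facts together
(`exists_map_fire_of_body`).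

Several query atoms may share nulls, and this is where resumption enters. Among the nulls hit by the
query pick one that is minimal for nesting, and let `θ₀` be its trigger. The result of `θ₀` has a
copy in `J`; freeze it. Facts descending from `θ₀` are derived again from the frozen copy, with ward
atoms replaced and side atoms kept, which is consistent because a ward shares only constants with
the side atoms (`resume_mem_ochase`). Each round thus turns at least one more query variable into a
constant. After `|vars(q)|` rounds all are constants, and one further round places every query atom
in the result. -/

theorem Atom.map_congr {T T' : Type*} {f g : T → T'} {a : Atom ar T}
    (h : ∀ i, f (a.args i) = g (a.args i)) : a.map f = a.map g := by
  simp only [Atom.map, h]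

theorem finite_setOf_hasVar (a : Atom ar (Term C V)) : {x | a.HasVar x}.Finite := by
  refine ((Set.finite_range a.args).preimage (f := Term.var)
    (fun x _ y _ h => Term.var.inj h)).subset ?_
  rintro x ⟨i, hi⟩
  exact ⟨i, hi⟩

theorem finite_varsOf (A : Finset (Atom ar (Term C V))) : (varsOf A).Finite := by
  refine (A.finite_toSet.biUnion fun a _ => finite_setOf_hasVar a).subset ?_
  rintro x ⟨a, ha, hx⟩
  exact Set.mem_biUnion (Finset.mem_coe.2 ha) hx

theorem Value.isConstant_freeze (v : Value ar C V) : v.freeze.IsConstant := by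
  cases v <;> trivial

/-- A set of facts is null-free if only constants and frozen nulls occur in it. -/
def NullFree (I : Set (Fact ar C V)) : Prop := ∀ a ∈ I, ∀ i, (a.args i).IsConstant

theorem nullFree_freeze (I : Set (Fact ar C V)) : NullFree (freeze I) := by
  rintro _ ⟨a, _, rfl⟩ i
  exact Value.isConstant_freeze _

theorem freeze_ofDatabase (D : Finset (Atom ar C)) :
    freeze (ofDatabase D : Set (Fact ar C V)) = ofDatabase D := by
  simp only [freeze, ofDatabase, Set.image_image]
  rfl

/-- `w` is one of the values to which the trigger that invented the null `v` sends the body. -/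
def Value.Sub (w v : Value ar C V) : Prop :=
  ∃ (σ : Rule ar C V) (z : V) (θ : {x : V // x ∈ varsOf σ.body} → Value ar C V)
    (x : {x : V // x ∈ varsOf σ.body}), v = .null σ z θ ∧ w = θ x

/-- Values are well-founded trees. This order replaces the time at which a null is created. -/
theorem Value.wellFounded_sub : WellFounded (Value.Sub (ar := ar) (C := C) (V := V)) := by
  refine ⟨fun v => ?_⟩
  induction v with
  | const c => exact ⟨_, by rintro _ ⟨σ, z, θ, x, h, _⟩; cases h⟩
  | frozen a _ => exact ⟨_, by rintro _ ⟨σ, z, θ, x, h, _⟩; cases h⟩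
  | null σ z θ ih =>
    refine ⟨_, ?_⟩
    rintro _ ⟨σ', z', θ', x, h, rfl⟩
    cases h
    exact ih x

theorem Value.not_transGen_sub (v : Value ar C V) : ¬ Relation.TransGen Value.Sub v v :=
  fun h => Value.wellFounded_sub.transGen.asymmetric _ _ h h

theorem Value.ne_null (σ : Rule ar C V) (z : V)
    (θ : {x : V // x ∈ varsOf σ.body} → Value ar C V) (x) : θ x ≠ .null σ z θ := fun h =>
  Value.not_transGen_sub (θ x) (.single ⟨σ, z, θ, x, h, rfl⟩)

theorem extend_of_mem {σ : Rule ar C V} {θ : {x : V // x ∈ varsOf σ.body} → Value ar C V} {x : V}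
    (hx : x ∈ varsOf σ.body) : extend σ θ x = θ ⟨x, hx⟩ := dif_pos hx

theorem extend_of_notMem {σ : Rule ar C V} {θ : {x : V // x ∈ varsOf σ.body} → Value ar C V}
    {x : V} (hx : x ∉ varsOf σ.body) : extend σ θ x = .null σ x θ := dif_neg hx

/-- Mapping a fact that instantiates an atom amounts to instantiating the atom differently, as soon
as the two instantiations agree on the variables of the atom. -/
theorem map_map_eval {a : Atom ar (Term C V)} {h h' : V → Value ar C V}
    {f : Value ar C V → Value ar C V} (hf : ∀ c, f (.const c) = .const c)
    (hh : ∀ x, a.HasVar x → f (h x) = h' x) :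
    (a.map (Term.eval h)).map f = a.map (Term.eval h') := by
  refine Atom.map_congr (T := Term C V) (f := f ∘ Term.eval h) fun i => ?_
  cases hi : a.args i with
  | const c => exact hf c
  | var x => exact hh x ⟨i, hi⟩

theorem args_map_eval_of_eq {a : Atom ar (Term C V)} {h : V → Value ar C V}
    {i : Fin (ar a.pred)} {x : V} (hi : a.args i = .var x) :
    (a.map (Term.eval h)).args i = h x := by
  change Term.eval h (a.args i) = h x
  rw [hi]; rfl

end Basics

/-! ### Soundness: undoing the freezing. -/

section Soundness

variable {P : Type*} {ar : P → ℕ} {C V : Type*}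

/-- Turn all frozen nulls, at every depth, into nulls again. -/
def Value.unfreeze : Value ar C V → Value ar C V
  | .const c => .const c
  | .frozen a => a.unfreeze
  | .null σ z θ => .null σ z fun x => (θ x).unfreeze

theorem Value.unfreeze_freeze (v : Value ar C V) : v.freeze.unfreeze = v.unfreeze := by
  cases v <;> simp [Value.freeze, Value.unfreeze]

theorem unfreeze_extend (σ : Rule ar C V) (θ : {x : V // x ∈ varsOf σ.body} → Value ar C V)
    (x : V) : (extend σ θ x).unfreeze = extend σ (fun x => (θ x).unfreeze) x := by
  by_cases hx : x ∈ varsOf σ.body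
  · rw [extend_of_mem hx, extend_of_mem hx]
  · rw [extend_of_notMem hx, extend_of_notMem hx, Value.unfreeze]

variable {S : Finset (Rule ar C V)}

/-- Unfreezing commutes with firing: it sends the nulls of a trigger to those of the unfrozen
trigger, which is applicable in `ochase`. -/
theorem IStep.unfreeze_mem_ochase {I J I₀ : Set (Fact ar C V)} (hIJ : IStep S I J)
    (hI : ∀ a ∈ I, a.map Value.unfreeze ∈ ochase S I₀) :
    ∀ a ∈ J, a.map Value.unfreeze ∈ ochase S I₀ := by
  obtain ⟨σ, hσ, θ, happ, -, rfl⟩ := hIJ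
  have key (b : Atom ar (Term C V)) :
      (b.map (Term.eval (extend σ θ))).map Value.unfreeze =
        b.map (Term.eval (extend σ fun x => (θ x).unfreeze)) :=
    map_map_eval (fun _ => rfl) fun x _ => unfreeze_extend σ θ x
  rintro a (ha | ⟨b, hb, rfl⟩)
  · exact hI a ha
  · refine ochase.step σ hσ (fun x => (θ x).unfreeze) (fun b hb => ?_) _ ⟨b, hb, (key b).symm⟩
    rw [← key]
    exact hI _ (happ b hb)

theorem IsIChaseR.unfreeze_mem_ochase {D : Finset (Atom ar C)} {i : ℕ} {J : Set (Fact ar C V)}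
    (hJ : IsIChaseR S D i J) :
    ∀ a ∈ J, a.map Value.unfreeze ∈ ochase S (ofDatabase D) := by
  induction i generalizing J with
  | zero =>
    obtain rfl := hJ
    rintro _ ⟨a, ha, rfl⟩
    exact ochase.base _ ⟨a, ha, rfl⟩
  | succ i ih =>
    obtain ⟨K, hK, hKJ, -⟩ := hJ
    induction hKJ with
    | refl =>
      rintro _ ⟨a, ha, rfl⟩
      have h : (a.map Value.freeze).map Value.unfreeze = a.map Value.unfreeze :=
        Atom.map_congr (a := a) (f := Value.unfreeze ∘ Value.freeze) fun i => Value.unfreeze_freeze _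
      rw [h]
      exact ih hK a ha
    | tail _ hstep ih' => exact hstep.unfreeze_mem_ochase ih'

theorem IsIChaseR.entails_ochase {D : Finset (Atom ar C)} {i : ℕ} {J : Set (Fact ar C V)}
    (hJ : IsIChaseR S D i J) {q : Finset (Atom ar (Term C V))} (hq : Entails J q) :
    Entails (ochase S (ofDatabase D)) q := by
  obtain ⟨h, hh⟩ := hq
  refine ⟨fun x => (h x).unfreeze, fun a ha => ?_⟩
  rw [← map_map_eval (f := Value.unfreeze) (fun _ => rfl) fun _ _ => rfl]
  exact hJ.unfreeze_mem_ochase _ (hh a ha)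

end Soundness

/-! ### Termination of each round. -/

section Termination

variable {P : Type*} {ar : P → ℕ} {C V : Type*}

-- A finite partial injection of nulls extends to a permutation, since the full permutation group is
-- `n`-pretransitive for every `n`. `Isomorphic` asks for such a global bijection.
open scoped Classical in
theorem exists_perm_map_eq {X : Type*} [Finite X] (a b : X → Value ar C V)
    (hab : ∀ x y, a x = a y ↔ b x = b y) (ha : ∀ x, (a x).IsConstant → b x = a x)
    (hb : ∀ x, (b x).IsConstant → b x = a x) :
    ∃ h : Equiv.Perm (Value ar C V), (∀ v, v.IsConstant → h v = v) ∧ ∀ x, h (a x) = b x := by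
  let s : Set {v : Value ar C V // ¬ v.IsConstant} := {v | ∃ x, a x = v}
  have hs : Finite s := by
    refine Set.Finite.to_subtype (((Set.finite_range a).preimage
      (Subtype.val_injective.injOn)).subset ?_)
    rintro v ⟨x, hx⟩
    exact ⟨x, hx⟩
  choose c hc using fun v : s => v.2
  have hbc (v : s) : ¬ (b (c v)).IsConstant := fun h => by
    have := hb _ h
    rw [this, hc] at h
    exact v.1.2 h
  let φ : s ↪ {v : Value ar C V // ¬ v.IsConstant} :=
    ⟨fun v => ⟨b (c v), hbc v⟩, fun v w hvw => by
      have h1 : a (c v) = a (c w) := (hab _ _).2 (Subtype.ext_iff.1 hvw)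
      rw [hc, hc] at h1
      exact Subtype.ext (Subtype.ext h1)⟩
  let e := Finite.equivFin s
  have := Equiv.Perm.isMultiplyPretransitive {v : Value ar C V // ¬ v.IsConstant} (Nat.card s)
  obtain ⟨g, hg⟩ := MulAction.exists_smul_eq
    (Equiv.Perm {v : Value ar C V // ¬ v.IsConstant})
    (e.symm.toEmbedding.trans (Function.Embedding.subtype _))
    (e.symm.toEmbedding.trans φ)
  have hg' (v : s) : g v = φ v := by
    have := DFunLike.congr_fun hg (e v)
    rw [Function.Embedding.smul_apply] at this
    simpa only [Function.Embedding.trans_apply, Equiv.toEmbedding_apply, Equiv.symm_apply_apply,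
      Function.Embedding.coe_subtype, Equiv.Perm.smul_def] using this
  refine ⟨Equiv.Perm.ofSubtype g, fun v hv => ?_, fun x => ?_⟩
  · exact Equiv.Perm.ofSubtype_apply_of_not_mem g (not_not.2 hv)
  · by_cases hx : (a x).IsConstant
    · rw [Equiv.Perm.ofSubtype_apply_of_not_mem g (not_not.2 hx), ha x hx]
    · have h1 := Equiv.Perm.ofSubtype_apply_coe g ⟨a x, hx⟩
      rw [hg' ⟨⟨a x, hx⟩, x, rfl⟩] at h1
      refine h1.trans ?_
      exact (hab _ _).1 (hc ⟨⟨a x, hx⟩, x, rfl⟩)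

/-- Two triggers of the same rule that agree on constants and identify the same variables produce
isomorphic facts. -/
theorem isomorphic_fire {σ : Rule ar C V} {θ θ' : {x : V // x ∈ varsOf σ.body} → Value ar C V}
    (heq : ∀ x y, θ x = θ y ↔ θ' x = θ' y) (hc : ∀ x, (θ x).IsConstant → θ' x = θ x)
    (hc' : ∀ x, (θ' x).IsConstant → θ' x = θ x) : Isomorphic (fire σ θ) (fire σ θ') := by
  have : Finite {x // x ∈ varsOf σ.head} := (finite_varsOf σ.head).to_subtype
  obtain ⟨h, hconst, hh⟩ := exists_perm_map_eq
    (fun x : {x // x ∈ varsOf σ.head} => extend σ θ x) (fun x => extend σ θ' x)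
    (fun x y => by
      by_cases hx : x.1 ∈ varsOf σ.body <;> by_cases hy : y.1 ∈ varsOf σ.body
      · simpa only [extend_of_mem hx, extend_of_mem hy] using heq _ _
      · simp only [extend_of_mem hx, extend_of_notMem hy, Value.ne_null]
      · simp only [extend_of_notMem hx, extend_of_mem hy, (Value.ne_null _ _ _ _).symm]
      · simp [extend_of_notMem hx, extend_of_notMem hy])
    (fun x => by
      by_cases hx : x.1 ∈ varsOf σ.body
      · simpa only [extend_of_mem hx] using hc _
      · simp only [extend_of_notMem hx, Value.IsConstant, false_imp_iff])
    (fun x => by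
      by_cases hx : x.1 ∈ varsOf σ.body
      · simpa only [extend_of_mem hx] using hc' _
      · simp only [extend_of_notMem hx, Value.IsConstant, false_imp_iff])
  refine ⟨h, hconst, ?_⟩
  rw [fire, fire, Set.image_image]
  refine Set.image_congr fun a ha => ?_
  exact map_map_eval (fun c => hconst _ trivial) fun x hx => hh ⟨x, a, ha, hx⟩

/-- The isomorphism types of the triggers of the rules of `S` over the constants in `K`. -/
abbrev TriggerType (S : Finset (Rule ar C V)) (K : Set (Value ar C V)) :=
  (σ : {σ // σ ∈ S}) × (({x : V // x ∈ varsOf σ.1.body} → {x : V // x ∈ varsOf σ.1.body} → Prop) ×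
    ({x : V // x ∈ varsOf σ.1.body} → Set K))

/-- The isomorphism type of a trigger. -/
def triggerType {S : Finset (Rule ar C V)} (K : Set (Value ar C V)) (σ : {σ // σ ∈ S})
    (θ : {x : V // x ∈ varsOf σ.1.body} → Value ar C V) : TriggerType S K :=
  ⟨σ, fun x y => θ x = θ y, fun x => {c | c.1 = θ x}⟩

theorem finite_triggerType (S : Finset (Rule ar C V)) (K : Set (Value ar C V)) [Finite K] :
    Finite (TriggerType S K) := by
  have (σ : {σ // σ ∈ S}) : Finite {x : V // x ∈ varsOf σ.1.body} :=
    (finite_varsOf σ.1.body).to_subtype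
  infer_instance

/-- The types of the triggers with constants in `K` whose result is in `J`. -/
def firedTypes (S : Finset (Rule ar C V)) (K : Set (Value ar C V)) (J : Set (Fact ar C V)) :
    Set (TriggerType S K) :=
  {t | ∃ σ θ, (∀ x, (θ x).IsConstant → θ x ∈ K) ∧ fire σ.1 θ ⊆ J ∧ triggerType K σ θ = t}

theorem isomorphic_of_triggerType_eq {S : Finset (Rule ar C V)} {K : Set (Value ar C V)}
    {σ σ' : {σ // σ ∈ S}} {θ θ'}
    (hθ : ∀ x, (θ x).IsConstant → θ x ∈ K) (hθ' : ∀ x, (θ' x).IsConstant → θ' x ∈ K)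
    (h : triggerType K σ θ = triggerType K σ' θ') :
    Isomorphic (fire σ.1 θ) (fire σ'.1 θ') := by
  obtain rfl : σ = σ' := congrArg Sigma.fst h
  simp only [triggerType, Sigma.mk.injEq, heq_eq_eq, true_and, Prod.mk.injEq] at h
  refine isomorphic_fire (fun x y => iff_of_eq (congrFun (congrFun h.1 x) y)) (fun x hx => ?_)
    fun x hx => ?_
  · have h2 : (⟨θ x, hθ x hx⟩ : K) ∈ {c : K | c.1 = θ x} := rfl
    rw [congrFun h.2 x] at h2
    exact h2.symm
  · have h2 : (⟨θ' x, hθ' x hx⟩ : K) ∈ {c : K | c.1 = θ' x} := rfl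
    rw [← congrFun h.2 x] at h2
    exact h2

theorem finite_fire (σ : Rule ar C V) (θ : {x : V // x ∈ varsOf σ.body} → Value ar C V) :
    (fire σ θ).Finite := σ.head.finite_toSet.image _

theorem IStep.finite {S : Finset (Rule ar C V)} {I J : Set (Fact ar C V)} (h : IStep S I J)
    (hI : I.Finite) : J.Finite := by
  obtain ⟨σ, -, θ, -, -, rfl⟩ := h
  exact hI.union (finite_fire σ θ)

theorem IsIChase.finite {S : Finset (Rule ar C V)} {I J : Set (Fact ar C V)} (h : IsIChase S I J)
    (hI : I.Finite) : J.Finite := by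
  obtain ⟨h, -⟩ := h
  induction h with
  | refl => exact hI
  | tail _ hs ih => exact hs.finite ih

/-- Each step fires a trigger type that was not fired before, so the number of unfired types
decreases. Firing brings in no constant outside `K`, because invented values are nulls. -/
theorem exists_isIChase_of_constants (S : Finset (Rule ar C V)) {K : Set (Value ar C V)}
    (hK : K.Finite)
    (hS : ∀ σ ∈ S, ∀ a ∈ σ.head, ∀ i c, a.args i = .const c → Value.const c ∈ K)
    (I : Set (Fact ar C V)) (hI : ∀ a ∈ I, ∀ i, (a.args i).IsConstant → a.args i ∈ K) :
    ∃ J, IsIChase S I J := by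
  have := hK.to_subtype
  have := finite_triggerType S K
  induction hn : (firedTypes S K I)ᶜ.ncard using Nat.strong_induction_on generalizing I with
  | _ n ih =>
  by_cases hfin : ∀ J, ¬ IStep S I J
  · exact ⟨I, .refl, hfin⟩
  push Not at hfin
  obtain ⟨J, hIJ⟩ := hfin
  obtain ⟨σ, hσ, θ, happ, hiso, hJ⟩ := hIJ
  have hθ (x) (hx : (θ x).IsConstant) : θ x ∈ K := by
    obtain ⟨x, b, hb, i, hi⟩ := x
    have h1 := hI _ (happ b hb) i
    rw [args_map_eval_of_eq hi, extend_of_mem ⟨b, hb, i, hi⟩] at h1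
    exact h1 hx
  have hlt : (firedTypes S K J)ᶜ.ncard < n := by
    rw [← hn]
    refine Set.ncard_lt_ncard ?_
    rw [compl_lt_compl_iff_lt, Set.ssubset_iff_of_subset]
    · refine ⟨triggerType K ⟨σ, hσ⟩ θ, ⟨⟨σ, hσ⟩, θ, hθ, ?_, rfl⟩, ?_⟩
      · rw [hJ]
        exact Set.subset_union_right
      -- Had this type been fired before, an isomorphic copy would be present and the step would be
      -- blocked.
      · rintro ⟨σ', θ', hθ', hsub, ht⟩
        exact hiso ⟨_, hsub, isomorphic_of_triggerType_eq hθ hθ' ht.symm⟩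
    · rintro _ ⟨σ', θ', hθ', hsub, rfl⟩
      exact ⟨σ', θ', hθ', hJ ▸ hsub.trans Set.subset_union_left, rfl⟩
  obtain ⟨L, hJL, hL⟩ := ih _ hlt J (by
    rw [hJ]
    rintro a (ha | ⟨b, hb, rfl⟩) i hi
    · exact hI a ha i hi
    · change (Term.eval (extend σ θ) (b.args i)).IsConstant at hi
      change Term.eval (extend σ θ) (b.args i) ∈ K
      cases hbi : b.args i with
      | const c => exact hS σ hσ b hb i c hbi
      | var x =>
        rw [hbi] at hi
        simp only [Term.eval] at hi ⊢
        by_cases hx : x ∈ varsOf σ.body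
        · rw [extend_of_mem hx] at hi ⊢
          exact hθ _ hi
        · rw [extend_of_notMem hx] at hi
          exact hi.elim) rfl
  exact ⟨L, .head ⟨σ, hσ, θ, happ, hiso, hJ⟩ hJL, hL⟩

theorem exists_isIChase (S : Finset (Rule ar C V)) {I : Set (Fact ar C V)} (hI : I.Finite) :
    ∃ J, IsIChase S I J := by
  let K : Set (Value ar C V) :=
    (⋃ a ∈ I, Set.range a.args) ∪
      ⋃ σ ∈ S, ⋃ a ∈ σ.head, Value.const '' (Term.const ⁻¹' Set.range a.args)
  refine exists_isIChase_of_constants S (K := K) (Set.Finite.union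
    (hI.biUnion fun a _ => Set.finite_range _) (S.finite_toSet.biUnion fun σ _ =>
      σ.head.finite_toSet.biUnion fun a _ => .image _ ((Set.finite_range a.args).preimage
        fun x _ y _ h => Term.const.inj h)))
    (fun σ hσ a ha i c hc => .inr ?_) I
    fun a ha i _ => .inl (Set.mem_biUnion ha ⟨i, rfl⟩)
  exact Set.mem_biUnion hσ (Set.mem_biUnion ha ⟨c, ⟨i, hc⟩, rfl⟩)

theorem exists_isIChaseR (S : Finset (Rule ar C V)) (D : Finset (Atom ar C)) (i : ℕ) :
    ∃ J, IsIChaseR S D i J ∧ J.Finite := by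
  induction i with
  | zero => exact ⟨_, rfl, D.finite_toSet.image _⟩
  | succ i ih =>
    obtain ⟨K, hK, hfin⟩ := ih
    have hfin' : (freeze K).Finite := hfin.image _
    obtain ⟨J, hJ⟩ := exists_isIChase S hfin'
    exact ⟨J, ⟨K, hK, hJ⟩, hJ.finite hfin'⟩

end Termination

/-! ### Completeness: where nulls may occur in the oblivious chase. -/

section Completeness

variable {P : Type*} {ar : P → ℕ} {C V : Type*} {S : Finset (Rule ar C V)}
  {I J : Set (Fact ar C V)}

theorem Invaded.mem {ρ : Rule ar C V} {y : V} {π : Position ar} (h : Invaded S ρ y π) :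
    ρ ∈ S ∧ y ∈ ρ.exVars := by
  induction h with
  | exist hρ hy => exact ⟨hρ, hy⟩
  | propagate σ hσ x hx a ha i hi hinv ih =>
    obtain ⟨b, hb, j, hj⟩ := hx
    exact ih b hb j hj

/-- A non-constant value in a head comes from an existential variable or from a variable all of
whose body occurrences carry the same value, which is the recursion defining `Affected`. -/
theorem affected_of_mem_ochase (hI : NullFree I) {a : Fact ar C V} (ha : ochase S I a)
    (i : Fin (ar a.pred)) (hi : ¬ (a.args i).IsConstant) : Affected S ⟨a.pred, i⟩ := by
  induction ha with
  | base a ha => exact (hi (hI a ha i)).elim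
  | step σ hσ θ hbody a ha ih =>
    obtain ⟨a, ha, rfl⟩ := ha
    change Fin (ar a.pred) at i
    cases hai : a.args i with
    | const c => exact (hi (by change (Term.eval _ (a.args i)).IsConstant; rw [hai]; trivial)).elim
    | var x =>
      rw [args_map_eval_of_eq hai] at hi
      by_cases hx : x ∈ varsOf σ.body
      · refine Affected.propagate σ hσ x hx a ha i hai fun b hb j hj => ih b hb j ?_
        rwa [args_map_eval_of_eq hj]
      · exact Affected.exist σ hσ x ⟨⟨a, ha, i, hai⟩, hx⟩ a ha i hai

theorem invaded_of_mem_ochase (hI : NullFree I) {a : Fact ar C V} (ha : ochase S I a)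
    (i : Fin (ar a.pred)) {ρ y τ} (hi : a.args i = .null ρ y τ) : Invaded S ρ y ⟨a.pred, i⟩ := by
  induction ha with
  | base a ha => exact (hi ▸ hI a ha i : Value.IsConstant (.null ρ y τ)).elim
  | step σ hσ θ hbody a ha ih =>
    obtain ⟨a, ha, rfl⟩ := ha
    change Fin (ar a.pred) at i
    cases hai : a.args i with
    | const c =>
      change Term.eval _ (a.args i) = _ at hi
      rw [hai] at hi
      cases hi
    | var x =>
      rw [args_map_eval_of_eq hai] at hi
      by_cases hx : x ∈ varsOf σ.body
      · refine Invaded.propagate σ hσ x hx a ha i hai fun b hb j hj => ih b hb j ?_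
        rwa [args_map_eval_of_eq hj]
      · rw [extend_of_notMem hx] at hi
        cases hi
        exact Invaded.exist hσ ⟨⟨a, ha, i, hai⟩, hx⟩ a ha i hai

/-- The trigger that invented a null of the oblivious chase is a trigger of the oblivious chase. -/
theorem body_mem_ochase_of_null (hI : NullFree I) {a : Fact ar C V} (ha : ochase S I a)
    (i : Fin (ar a.pred)) {ρ y τ} (hi : a.args i = .null ρ y τ) :
    ρ ∈ S ∧ ∀ b ∈ ρ.body, ochase S I (b.map (Term.eval (extend ρ τ))) := by
  induction ha with
  | base a ha => exact (hi ▸ hI a ha i : Value.IsConstant (.null ρ y τ)).elim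
  | step σ hσ θ hbody a ha ih =>
    obtain ⟨a, ha, rfl⟩ := ha
    change Fin (ar a.pred) at i
    cases hai : a.args i with
    | const c =>
      change Term.eval _ (a.args i) = _ at hi
      rw [hai] at hi
      cases hi
    | var x =>
      rw [args_map_eval_of_eq hai] at hi
      by_cases hx : x ∈ varsOf σ.body
      · obtain ⟨b, hb, j, hj⟩ := id hx
        refine ih b hb j ?_
        rwa [args_map_eval_of_eq hj]
      · rw [extend_of_notMem hx] at hi
        cases hi
        exact ⟨hσ, hbody⟩

section Trigger

variable {σ : Rule ar C V} {θ : {x : V // x ∈ varsOf σ.body} → Value ar C V}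

/-- If the value were a null invented for `y`, every body occurrence of `x` would be in a position
invaded by `y`, so `y` would attack `x`. -/
theorem isConstant_of_protectedVar (hI : NullFree I)
    (hbody : ∀ b ∈ σ.body, ochase S I (b.map (Term.eval (extend σ θ))))
    {x : V} (hx : x ∈ varsOf σ.body) (hp : ProtectedVar S σ x) : (θ ⟨x, hx⟩).IsConstant := by
  cases hv : θ ⟨x, hx⟩ with
  | const c => trivial
  | frozen a => trivial
  | null ρ y τ =>
    have hinv : ∀ b ∈ σ.body, ∀ j : Fin (ar b.pred), b.args j = Term.var x →
        Invaded S ρ y ⟨b.pred, j⟩ := fun b hb j hj =>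
      invaded_of_mem_ochase hI (hbody b hb) j
        ((args_map_eval_of_eq hj).trans ((extend_of_mem hx).trans hv))
    obtain ⟨b, hb, j, hj⟩ := id hx
    obtain ⟨hρ, hy⟩ := (hinv b hb j hj).mem
    exact (hp ρ hρ y hy ⟨hx, hinv⟩).elim

theorem isConstant_of_harmless (hI : NullFree I)
    (hbody : ∀ b ∈ σ.body, ochase S I (b.map (Term.eval (extend σ θ))))
    {x : V} (hx : x ∈ varsOf σ.body) (hh : Harmless S σ x) : (θ ⟨x, hx⟩).IsConstant := by
  by_contra hc
  obtain ⟨b, hb, j, hj, haff⟩ := hh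
  refine haff (affected_of_mem_ochase hI (hbody b hb) j ?_)
  rwa [args_map_eval_of_eq hj, extend_of_mem hx]

theorem dangerous_of_not_isConstant (hI : NullFree I)
    (hbody : ∀ b ∈ σ.body, ochase S I (b.map (Term.eval (extend σ θ))))
    {x : V} (hx : x ∈ varsOf σ.body) (hx' : x ∈ varsOf σ.head)
    (hc : ¬ (θ ⟨x, hx⟩).IsConstant) : Dangerous S σ x :=
  ⟨hx, fun h => hc (isConstant_of_harmless hI hbody hx h), hx'⟩

end Trigger

/-! ### One round captures each single fact. -/

/-- A map of values that fixes everything but the nulls. -/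
def FixesConstants (g : Value ar C V → Value ar C V) : Prop := ∀ v, v.IsConstant → g v = v

/-- Facts that map into the result of an isomorphic chase one by one have consequences that map into
it together. -/
theorem exists_map_fire_of_body (hS : Protected S) (hI : NullFree I) (hJ : ∀ K, ¬ IStep S J K)
    {σ : Rule ar C V} (hσ : σ ∈ S) {θ : {x : V // x ∈ varsOf σ.body} → Value ar C V}
    (hbody : ∀ b ∈ σ.body, ochase S I (b.map (Term.eval (extend σ θ))))
    (hmap : ∀ b ∈ σ.body, ∃ g, FixesConstants g ∧ (b.map (Term.eval (extend σ θ))).map g ∈ J) :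
    ∃ g, FixesConstants g ∧ ∀ a ∈ fire σ θ, a.map g ∈ J := by
  classical
  have : Nonempty (Value ar C V → Value ar C V) := ⟨id⟩
  choose! g hg hgJ using hmap
  choose c hc hcx using fun x : {x : V // x ∈ varsOf σ.body} => x.2
  let θ' : {x : V // x ∈ varsOf σ.body} → Value ar C V := fun x => g (c x) (θ x)
  have hθ' (b) (hb : b ∈ σ.body) (x : V) (hbx : b.HasVar x) :
      g b (θ ⟨x, b, hb, hbx⟩) = θ' ⟨x, b, hb, hbx⟩ := by
    by_cases hbc : b = c ⟨x, b, hb, hbx⟩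
    · exact congrArg (fun d => g d (θ ⟨x, b, hb, hbx⟩)) hbc
    -- A variable in two body atoms is protected by Shy, so its value is a constant and both maps
    -- fix it. Hence the choice of atom in `θ'` is immaterial.
    · have hconst := isConstant_of_protectedVar hI hbody ⟨b, hb, hbx⟩
        ((hS.1 σ hσ).1 x b hb _ (hc _) hbc hbx (hcx _))
      exact (hg b hb _ hconst).trans (hg _ (hc _) _ hconst).symm
  have happ : Applicable σ θ' J := fun b hb => by
    rw [← map_map_eval (h := extend σ θ) (f := g b) (fun _ => hg b hb _ trivial) fun x hx => ?_]
    · exact hgJ b hb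
    · have hx' : x ∈ varsOf σ.body := ⟨b, hb, hx⟩
      rw [extend_of_mem hx', extend_of_mem hx']
      exact hθ' b hb x hx
  have hiso : ∃ B ⊆ J, Isomorphic (fire σ θ') B := by
    by_contra h
    exact hJ _ ⟨σ, hσ, θ', happ, h, rfl⟩
  obtain ⟨B, hBJ, h, hh, rfl⟩ := hiso
  -- One map must agree with `θ'` on all head variables. Non-constant values come only from
  -- dangerous variables, all in the ward `w`, so `g w` works; without dangerous variables the
  -- identity does.
  obtain ⟨k, hk, hkθ⟩ : ∃ k, FixesConstants k ∧ ∀ x (hx : x ∈ varsOf σ.body),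
      x ∈ varsOf σ.head → k (θ ⟨x, hx⟩) = θ' ⟨x, hx⟩ := by
    rcases hS.2 σ hσ with hno | ⟨w, hw, hdang, -⟩
    · refine ⟨id, fun _ _ => rfl, fun x hx hxh => ?_⟩
      have hconst : (θ ⟨x, hx⟩).IsConstant := by
        by_contra hnc
        exact hno x (dangerous_of_not_isConstant hI hbody hx hxh hnc)
      exact (hg _ (hc _) _ hconst).symm
    · refine ⟨g w, hg w hw, fun x hx hxh => ?_⟩
      by_cases hconst : (θ ⟨x, hx⟩).IsConstant
      · exact (hg w hw _ hconst).trans (hg _ (hc _) _ hconst).symm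
      · exact hθ' w hw x (hdang x (dangerous_of_not_isConstant hI hbody hx hxh hconst))
  -- Nulls invented by `θ` go to those invented by `θ'`, other values go along `k`; then `h` moves
  -- everything to the copy present in `J`.
  let f : Value ar C V → Value ar C V := fun v =>
    if hv : ∃ z, v = .null σ z θ then h (.null σ hv.choose θ') else h (k v)
  have hf (v) (hv : ¬ ∃ z, v = .null σ z θ) : f v = h (k v) := dif_neg hv
  have hfnull (z) : f (.null σ z θ) = h (.null σ z θ') := by
    have hv : ∃ z', Value.null σ z θ = .null σ z' θ := ⟨z, rfl⟩
    have hz : hv.choose = z := by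
      have h1 := hv.choose_spec
      generalize hv.choose = z' at h1 ⊢
      cases h1
      rfl
    refine (dif_pos hv).trans ?_
    rw [hz]
  have hfc : FixesConstants f := fun v hv => by
    rw [hf v (by rintro ⟨z, rfl⟩; exact hv), hk v hv, hh v hv]
  refine ⟨f, hfc, ?_⟩
  rintro _ ⟨a, ha, rfl⟩
  refine hBJ ⟨_, ⟨a, ha, rfl⟩, ?_⟩
  rw [map_map_eval (f := h) (h' := h ∘ extend σ θ') (fun _ => hh _ trivial) fun _ _ => rfl]
  refine (map_map_eval (fun _ => hfc _ trivial) fun x hx => ?_).symm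
  by_cases hxb : x ∈ varsOf σ.body
  · rw [extend_of_mem hxb, hf _ (by rintro ⟨z, hz⟩; exact Value.ne_null _ _ _ _ hz),
      hkθ x hxb ⟨a, ha, hx⟩, Function.comp, extend_of_mem hxb]
  · rw [extend_of_notMem hxb, hfnull, Function.comp, extend_of_notMem hxb]

theorem exists_map_mem (hS : Protected S) (hI : NullFree I) (hIJ : I ⊆ J)
    (hJ : ∀ K, ¬ IStep S J K) {a : Fact ar C V} (ha : ochase S I a) :
    ∃ g, FixesConstants g ∧ a.map g ∈ J := by
  induction ha with
  | base a ha => exact ⟨id, fun _ _ => rfl, hIJ ha⟩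
  | step σ hσ θ hbody a ha ih =>
    obtain ⟨g, hg, hgJ⟩ := exists_map_fire_of_body hS hI hJ hσ hbody ih
    exact ⟨g, hg, hgJ a ha⟩

/-! ### Replaying the chase from a frozen result. -/

/-- Freeze once more the frozen nulls that occur in a value, at every depth of its nulls. -/
def Value.refreeze : Value ar C V → Value ar C V
  | .const c => .const c
  | .frozen a => .frozen (.frozen a)
  | .null σ z θ => .null σ z fun x => (θ x).refreeze

theorem Value.refreeze_of_isConstant {v : Value ar C V} (hv : v.IsConstant) :
    v.refreeze = v.freeze := by
  cases v with
  | const c => rfl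
  | frozen a => rfl
  | null σ z θ => exact hv.elim

/-- Renaming constants by `freeze`, also inside the labels of nulls, carries a derivation from `I`
to one from `freeze J`, which contains `freeze I`. -/
theorem refreeze_mem_ochase (hI : NullFree I) (hIJ : I ⊆ J) {a : Fact ar C V}
    (ha : ochase S I a) : ochase S (freeze J) (a.map Value.refreeze) := by
  induction ha with
  | base a ha =>
    exact .base _ ⟨a, hIJ ha,
      Atom.map_congr fun i => (Value.refreeze_of_isConstant (hI a ha i)).symm⟩
  | step σ hσ θ hbody a ha ih =>
    have key (b : Atom ar (Term C V)) :
        (b.map (Term.eval (extend σ θ))).map Value.refreeze =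
          b.map (Term.eval (extend σ fun x => (θ x).refreeze)) :=
      map_map_eval (fun _ => rfl) fun x _ => by
        by_cases hx : x ∈ varsOf σ.body
        · rw [extend_of_mem hx, extend_of_mem hx]
        · rw [extend_of_notMem hx, extend_of_notMem hx, Value.refreeze]
    obtain ⟨a, ha, rfl⟩ := ha
    exact .step σ hσ (fun x => (θ x).refreeze) (fun b hb => key b ▸ ih b hb) _
      ⟨a, ha, (key a).symm⟩

/-- `W σ` is a set of variables that contains the dangerous variables of `σ` and that is empty or
consists of the variables of a ward of `σ`. -/
def IsWard (S : Finset (Rule ar C V)) (σ : Rule ar C V) (W : Set V) : Prop :=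
  (∀ x, Dangerous S σ x → x ∈ W) ∧
    ∀ x ∈ W, ∃ a ∈ σ.body, W = {y | a.HasVar y} ∧
      ∀ b ∈ σ.body, b ≠ a → ∀ y ∈ W, b.HasVar y → Harmless S σ y

theorem Warded.exists_isWard (hS : Warded S) : ∃ W : Rule ar C V → Set V,
    ∀ σ ∈ S, IsWard S σ (W σ) := by
  have h (σ : Rule ar C V) : ∃ W, σ ∈ S → IsWard S σ W := by
    by_cases hσ : σ ∈ S
    · rcases hS σ hσ with hno | ⟨a, ha, hd, hw⟩
      · exact ⟨∅, fun _ => ⟨fun x hx => (hno x hx).elim, fun x hx => hx.elim⟩⟩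
      · exact ⟨{y | a.HasVar y}, fun _ => ⟨hd, fun x _ => ⟨a, ha, rfl, hw⟩⟩⟩
    · exact ⟨∅, fun h => (hσ h).elim⟩
  choose W hW using h
  exact ⟨W, hW⟩

section Resume

variable (W : Rule ar C V → Set V) (σ₀ : Rule ar C V)
  (θ₀ : {x : V // x ∈ varsOf σ₀.body} → Value ar C V)

/-- The nulls invented by the trigger `θ₀` of `σ₀`, and those that descend from them through the
sets of variables `W`. -/
inductive Descends : Value ar C V → Prop
  | new (z : V) : Descends (.null σ₀ z θ₀)
  | step (ρ : Rule ar C V) (y : V) (θ : {x : V // x ∈ varsOf ρ.body} → Value ar C V)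
      (x : {x : V // x ∈ varsOf ρ.body}) (hx : x.1 ∈ W ρ) (hd : Descends (θ x)) :
      Descends (.null ρ y θ)

/-- The values to which the trigger `θ₀` of `σ₀` sends the variables of `σ₀`. -/
def TriggerValue (v : Value ar C V) : Prop := (∃ z, v = .null σ₀ z θ₀) ∨ ∃ x, v = θ₀ x

open scoped Classical in
/-- Resume from a frozen copy, given by `g`, of the result of the trigger `θ₀` of `σ₀`. -/
noncomputable def resume (g : Value ar C V → Value ar C V) : Value ar C V → Value ar C V
  | .const c => .const c
  | .frozen a => .frozen (.frozen a)
  | .null ρ y θ =>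
    if TriggerValue σ₀ θ₀ (.null ρ y θ) then (g (.null ρ y θ)).freeze
    else if Descends W σ₀ θ₀ (.null ρ y θ) then
      .null ρ y fun x => if x.1 ∈ W ρ then resume g (θ x) else (θ x).refreeze
    else (Value.null ρ y θ).refreeze

variable {W σ₀ θ₀}

theorem Descends.not_isConstant {v : Value ar C V} (h : Descends W σ₀ θ₀ v) :
    ¬ v.IsConstant := by
  cases h <;> exact id

theorem Descends.exists_reflTransGen {v : Value ar C V} (h : Descends W σ₀ θ₀ v) :
    ∃ z, Relation.ReflTransGen Value.Sub (.null σ₀ z θ₀) v := by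
  induction h with
  | new z => exact ⟨z, .refl⟩
  | step ρ y θ x hx hd ih =>
    obtain ⟨z, hz⟩ := ih
    exact ⟨z, hz.tail ⟨ρ, y, θ, x, rfl, rfl⟩⟩

/-- `θ₀ x` is nested strictly inside the nulls of `θ₀`, which are nested in every descendant. So the
cases of `resume` do not clash. -/
theorem Descends.ne_apply {v : Value ar C V} (h : Descends W σ₀ θ₀ v) (x) : v ≠ θ₀ x := by
  rintro rfl
  obtain ⟨z, hz⟩ := h.exists_reflTransGen
  exact Value.not_transGen_sub _ (Relation.TransGen.head' ⟨σ₀, z, θ₀, x, rfl, rfl⟩ hz)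

variable {g : Value ar C V → Value ar C V}

theorem resume_of_isConstant {v : Value ar C V} (hv : v.IsConstant) :
    resume W σ₀ θ₀ g v = v.freeze := by
  cases v with
  | const c => simp [resume, Value.freeze]
  | frozen a => simp [resume, Value.freeze]
  | null σ z θ => exact hv.elim

theorem resume_of_triggerValue (hg : FixesConstants g) {v : Value ar C V}
    (hv : TriggerValue σ₀ θ₀ v) : resume W σ₀ θ₀ g v = (g v).freeze := by
  by_cases hc : v.IsConstant
  · rw [resume_of_isConstant hc, hg v hc]
  · cases v with
    | const c => exact (hc trivial).elim
    | frozen a => exact (hc trivial).elim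
    | null σ z θ => rw [resume, if_pos hv]

theorem resume_of_not_descends {v : Value ar C V} (hv : ¬ Descends W σ₀ θ₀ v)
    (hv' : v.IsConstant ∨ ∀ x, v ≠ θ₀ x) : resume W σ₀ θ₀ g v = v.refreeze := by
  by_cases hc : v.IsConstant
  · rw [resume_of_isConstant hc, Value.refreeze_of_isConstant hc]
  · cases v with
    | const c => exact (hc trivial).elim
    | frozen a => exact (hc trivial).elim
    | null σ z θ =>
      rw [resume, if_neg, if_neg hv]
      rintro (⟨z, hz⟩ | ⟨x, hx⟩)
      · exact hv (hz ▸ .new z)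
      · exact hv'.resolve_left id x hx

/-- A derivation is followed along the wards back to `θ₀`, whose result is replaced by the frozen
copy; side atoms are replayed with `refreeze`. The hypothesis `hd` matters: `resume` also freezes
values of `θ₀`, and facts unrelated to `θ₀` need not survive that. -/
theorem resume_mem_ochase (hI : NullFree I) (hIJ : I ⊆ J) (hW : ∀ σ ∈ S, IsWard S σ (W σ))
    (hg : FixesConstants g) (hgJ : ∀ a ∈ fire σ₀ θ₀, a.map g ∈ J) {a : Fact ar C V}
    (ha : ochase S I a) {i : Fin (ar a.pred)} (hd : Descends W σ₀ θ₀ (a.args i)) :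
    ochase S (freeze J) (a.map (resume W σ₀ θ₀ g)) := by
  classical
  induction ha with
  | base a ha => exact (hd.not_isConstant (hI a ha i)).elim
  | step ρ hρ θ hbody a ha ih =>
    obtain ⟨a, ha, rfl⟩ := ha
    change Fin (ar a.pred) at i
    -- Equality of nulls expresses that the triggers `(ρ, θ)` and `(σ₀, θ₀)` coincide, without
    -- heterogeneous equality.
    by_cases htr : ∃ z, Value.null ρ z θ = Value.null σ₀ z θ₀
    · obtain ⟨z, hz⟩ := htr
      cases hz
      refine .base _ ⟨_, hgJ _ ⟨a, ha, rfl⟩, Atom.map_congr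
        (a := a.map (Term.eval (extend σ₀ θ₀))) (f := Value.freeze ∘ g) fun j => ?_⟩
      change (g (Term.eval (extend σ₀ θ₀) (a.args j))).freeze =
        resume W σ₀ θ₀ g (Term.eval (extend σ₀ θ₀) (a.args j))
      cases a.args j with
      | const c =>
        change (g (.const c)).freeze = resume W σ₀ θ₀ g (.const c)
        rw [resume_of_isConstant (v := .const c) trivial, hg (.const c) trivial]
      | var x =>
        refine (resume_of_triggerValue hg ?_).symm
        by_cases hx : x ∈ varsOf σ₀.body
        · exact .inr ⟨⟨x, hx⟩, extend_of_mem hx⟩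
        · exact .inl ⟨x, extend_of_notMem hx⟩
    have htr' (y z) : Value.null ρ y θ ≠ Value.null σ₀ z θ₀ := fun h => by
      cases h
      exact htr ⟨y, rfl⟩
    obtain ⟨hdang, hward⟩ := hW ρ hρ
    have hnotW {x} (hx : x ∈ varsOf ρ.body) (hxh : x ∈ varsOf ρ.head) (hxW : x ∉ W ρ) :
        (θ ⟨x, hx⟩).IsConstant := by
      by_contra hc
      exact hxW (hdang x (dangerous_of_not_isConstant hI hbody hx hxh hc))
    -- A descendant in the head is inherited through a ward variable or newly invented from one;
    -- either way the ward atom has a descendant and the induction hypothesis applies to it.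
    obtain ⟨x, hxW, hxd⟩ : ∃ x : {x : V // x ∈ varsOf ρ.body}, x.1 ∈ W ρ ∧
        Descends W σ₀ θ₀ (θ x) := by
      change Descends W σ₀ θ₀ (Term.eval (extend ρ θ) (a.args i)) at hd
      cases hai : a.args i with
      | const c => rw [hai] at hd; cases hd
      | var x =>
        rw [hai, Term.eval] at hd
        by_cases hx : x ∈ varsOf ρ.body
        · rw [extend_of_mem hx] at hd
          refine ⟨⟨x, hx⟩, ?_, hd⟩
          by_contra hxW
          exact hd.not_isConstant (hnotW hx ⟨a, ha, i, hai⟩ hxW)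
        · rw [extend_of_notMem hx] at hd
          generalize hv : Value.null ρ x θ = v at hd
          cases hd with
          | new z => exact (htr' _ _ hv).elim
          | step ρ' y θ' x' hx' hd' =>
            cases hv
            exact ⟨x', hx', hd'⟩
    obtain ⟨w, hw, hWw, hharm⟩ := hward x hxW
    let θ' : {x : V // x ∈ varsOf ρ.body} → Value ar C V := fun x =>
      if x.1 ∈ W ρ then resume W σ₀ θ₀ g (θ x) else (θ x).refreeze
    have hθ' (b) (hb : b ∈ ρ.body) : ochase S (freeze J) (b.map (Term.eval (extend ρ θ'))) := by
      by_cases hbw : b = w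
      · subst hbw
        have hxb : b.HasVar x := by
          rw [hWw] at hxW
          exact hxW
        obtain ⟨j, hj⟩ := hxb
        have h1 := ih b hb (i := j) (by
          rw [args_map_eval_of_eq hj, extend_of_mem x.2]
          exact hxd)
        rwa [map_map_eval (h' := extend ρ θ') (fun c => resume_of_isConstant trivial)] at h1
        intro y hy
        have hyb : y ∈ varsOf ρ.body := ⟨b, hb, hy⟩
        rw [extend_of_mem hyb, extend_of_mem hyb]
        exact (if_pos (by rw [hWw]; exact hy)).symm
      · have h1 := refreeze_mem_ochase hI hIJ (hbody b hb)
        rwa [map_map_eval (h' := extend ρ θ') (fun c => rfl)] at h1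
        intro y hy
        have hyb : y ∈ varsOf ρ.body := ⟨b, hb, hy⟩
        rw [extend_of_mem hyb, extend_of_mem hyb]
        by_cases hyW : y ∈ W ρ
        -- A variable shared with the ward is harmless, so its value is a constant, where `resume`
        -- and `refreeze` agree.
        · have hc := isConstant_of_harmless hI hbody hyb (hharm b hb hbw y hyW hy)
          refine (Value.refreeze_of_isConstant hc).trans
            ((resume_of_isConstant (W := W) (θ₀ := θ₀) (g := g) hc).symm.trans ?_)
          exact (if_pos hyW).symm
        · exact (if_neg hyW).symm
    refine .step ρ hρ θ' hθ' _ ⟨a, ha, ?_⟩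
    refine (map_map_eval (fun c => resume_of_isConstant trivial) fun y hy => ?_).symm
    by_cases hyb : y ∈ varsOf ρ.body
    · rw [extend_of_mem hyb, extend_of_mem hyb]
      by_cases hyW : y ∈ W ρ
      · exact (if_pos hyW).symm
      · have hc := hnotW hyb ⟨a, ha, hy⟩ hyW
        refine (resume_of_isConstant hc).trans ((Value.refreeze_of_isConstant hc).symm.trans ?_)
        exact (if_neg hyW).symm
    · have hdesc : Descends W σ₀ θ₀ (.null ρ y θ) := .step ρ y θ x hxW hxd
      rw [extend_of_notMem hyb, extend_of_notMem hyb, resume, if_neg, if_pos hdesc]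
      rintro (⟨z, hz⟩ | ⟨x', hx'⟩)
      · exact htr' _ _ hz
      · exact hdesc.ne_apply x' hx'

end Resume

/-! ### Counting the query variables sent to nulls. -/

/-- The variables of a query that an assignment sends to nulls. -/
def nullVars (q : Finset (Atom ar (Term C V))) (h : V → Value ar C V) : Set V :=
  {x | x ∈ varsOf q ∧ ¬ (h x).IsConstant}

theorem finite_nullVars (q : Finset (Atom ar (Term C V))) (h : V → Value ar C V) :
    (nullVars q h).Finite := (finite_varsOf q).subset fun _ hx => hx.1

/-- A round of the isomorphic chase makes at least one more variable of a query that holds in the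
oblivious chase a constant. -/
theorem exists_ncard_nullVars_le (hS : Protected S) (hI : NullFree I) (hIJ : I ⊆ J)
    (hJ : ∀ K, ¬ IStep S J K) {q : Finset (Atom ar (Term C V))} {h : V → Value ar C V}
    (hq : ∀ a ∈ q, ochase S I (a.map (Term.eval h))) :
    ∃ h' : V → Value ar C V, (∀ a ∈ q, ochase S (freeze J) (a.map (Term.eval h'))) ∧
      (nullVars q h').ncard ≤ (nullVars q h).ncard - 1 := by
  have hfin := finite_nullVars q h
  rcases (nullVars q h).eq_empty_or_nonempty with hempty | hne
  · refine ⟨fun x => (h x).refreeze, fun a ha => ?_, ?_⟩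
    · rw [← map_map_eval (h := h) (f := Value.refreeze) (fun _ => rfl) fun _ _ => rfl]
      exact refreeze_mem_ochase hI hIJ (hq a ha)
    · refine (Set.ncard_le_ncard (t := ∅) (fun x hx => ?_)).trans (by simp)
      rw [← hempty]
      refine ⟨hx.1, fun hc => hx.2 ?_⟩
      change (h x).refreeze.IsConstant
      rw [Value.refreeze_of_isConstant hc]
      exact Value.isConstant_freeze _
  obtain ⟨n, ⟨x₀, hx₀, rfl⟩, hmin⟩ :=
    Value.wellFounded_sub.has_min (h '' nullVars q h) (hne.image h)
  obtain ⟨⟨a₀, ha₀, i₀, hi₀⟩, hnull⟩ := id hx₀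
  obtain ⟨σ₀, z, θ₀, hn⟩ : ∃ σ₀ z θ₀, h x₀ = .null σ₀ z θ₀ := by
    cases hv : h x₀ with
    | const c => exact (hnull (hv ▸ trivial)).elim
    | frozen a => exact (hnull (hv ▸ trivial)).elim
    | null σ z θ => exact ⟨σ, z, θ, rfl⟩
  obtain ⟨hσ₀, hbody⟩ := body_mem_ochase_of_null hI (hq a₀ ha₀) i₀
    ((args_map_eval_of_eq hi₀).trans hn)
  obtain ⟨g, hg, hgJ⟩ := exists_map_fire_of_body hS hI hJ hσ₀ hbody
    fun b hb => exists_map_mem hS hI hIJ hJ (hbody b hb)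
  obtain ⟨W, hW⟩ := hS.2.exists_isWard
  refine ⟨fun x => resume W σ₀ θ₀ g (h x), fun a ha => ?_, ?_⟩
  · by_cases hd : ∃ x, a.HasVar x ∧ Descends W σ₀ θ₀ (h x)
    · obtain ⟨x, ⟨i, hi⟩, hd⟩ := hd
      rw [← map_map_eval (h := h) (f := resume W σ₀ θ₀ g)
        (fun _ => resume_of_isConstant trivial) fun _ _ => rfl]
      exact resume_mem_ochase hI hIJ hW hg hgJ (hq a ha) (i := i)
        ((args_map_eval_of_eq hi).symm ▸ hd)
    · rw [← map_map_eval (h := h) (f := Value.refreeze) (fun _ => rfl)]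
      · exact refreeze_mem_ochase hI hIJ (hq a ha)
      · intro x hx
        refine (resume_of_not_descends (fun h => hd ⟨x, hx, h⟩) ?_).symm
        refine or_iff_not_imp_left.2 fun hc y hy => ?_
        -- By minimality no query variable is sent to a null among the values of `θ₀`, so `resume`
        -- is `refreeze` on this atom.
        exact hmin (h x) ⟨x, ⟨⟨a, ha, hx⟩, hc⟩, rfl⟩ ⟨σ₀, z, θ₀, y, hn, hy⟩
  -- Constants stay constants, and `x₀` becomes one.
  · rw [← Set.ncard_sdiff_singleton_of_mem hx₀]
    refine Set.ncard_le_ncard ?_ hfin.sdiff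
    rintro x ⟨hxq, hx⟩
    refine ⟨⟨hxq, fun hc => hx ?_⟩, ?_⟩
    · beta_reduce
      rw [resume_of_isConstant hc]
      exact Value.isConstant_freeze _
    · rintro rfl
      refine hx ?_
      beta_reduce
      rw [resume_of_triggerValue hg (.inl ⟨z, hn⟩)]
      exact Value.isConstant_freeze _

theorem IsIChase.subset (h : IsIChase S I J) : I ⊆ J := by
  obtain ⟨h, -⟩ := h
  induction h with
  | refl => exact subset_rfl
  | tail _ hs ih =>
    obtain ⟨σ, -, θ, -, -, rfl⟩ := hs
    exact ih.trans Set.subset_union_left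

theorem IsIChaseR.exists_ncard_nullVars_le (hS : Protected S) {D : Finset (Atom ar C)}
    {q : Finset (Atom ar (Term C V))} (hq : Entails (ochase S (ofDatabase D)) q) {i : ℕ}
    {K : Set (Fact ar C V)} (hK : IsIChaseR S D i K) :
    ∃ h : V → Value ar C V, (∀ a ∈ q, ochase S (freeze K) (a.map (Term.eval h))) ∧
      (nullVars q h).ncard ≤ (varsOf q).ncard - i := by
  induction i generalizing K with
  | zero =>
    obtain rfl := hK
    obtain ⟨h, hh⟩ := hq
    rw [freeze_ofDatabase]
    exact ⟨h, hh, Set.ncard_le_ncard (fun x hx => hx.1) (finite_varsOf q)⟩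
  | succ i ih =>
    obtain ⟨L, hL, hLK⟩ := hK
    obtain ⟨h, hh, hcard⟩ := ih hL
    obtain ⟨h', hh', hcard'⟩ :=
      ExRules.exists_ncard_nullVars_le hS (nullFree_freeze L) hLK.subset hLK.2 hh
    exact ⟨h', hh', by omega⟩

/-- After `|vars(q)|` rounds the match uses constants only. The maps of single facts into the last
round then fix every query atom, so they need not be compatible. -/
theorem IsIChaseR.entails_of_ochase (hS : Protected S) {D : Finset (Atom ar C)}
    {q : Finset (Atom ar (Term C V))} (hq : Entails (ochase S (ofDatabase D)) q)
    {J : Set (Fact ar C V)} (hJ : IsIChaseR S D ((varsOf q).ncard + 1) J) : Entails J q := by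
  obtain ⟨K, hK, hKJ⟩ := hJ
  obtain ⟨h, hh, hcard⟩ := hK.exists_ncard_nullVars_le hS hq
  have hempty : nullVars q h = ∅ := by
    rw [← Set.ncard_eq_zero (finite_nullVars q h)]
    omega
  refine ⟨h, fun a ha => ?_⟩
  obtain ⟨g, hg, hgJ⟩ := exists_map_mem hS (nullFree_freeze K) hKJ.subset hKJ.2 (hh a ha)
  rwa [map_map_eval (h' := h) (fun _ => hg _ trivial)] at hgJ
  intro x hx
  refine hg _ ?_
  by_contra hc
  have : x ∈ nullVars q h := ⟨⟨a, ha, hx⟩, hc⟩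
  simp [hempty] at this

end Completeness

end ExRules

theorem mainTheorem10 {P C V : Type*} (ar : P → ℕ)
    (S : Finset (ExRules.Rule ar C V)) (hS : ExRules.Protected S)
    (D : Finset (ExRules.Atom ar C))
    (q : Finset (ExRules.Atom ar (ExRules.Term C V))) :
    (∃ J, ExRules.IsIChaseR S D ((ExRules.varsOf q).ncard + 1) J) ∧
    ∀ J, ExRules.IsIChaseR S D ((ExRules.varsOf q).ncard + 1) J →
      (ExRules.Entails (ExRules.ochase S (ExRules.ofDatabase D)) q ↔ ExRules.Entails J q) := by
  obtain ⟨J, hJ, -⟩ := ExRules.exists_isIChaseR S D ((ExRules.varsOf q).ncard + 1)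
  exact ⟨⟨J, hJ⟩, fun J hJ => ⟨fun hq => hJ.entails_of_ochase hS hq, hJ.entails_ochase⟩⟩
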